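/- Let $A\in\mathbb R^{n\times n}$, $B\in\mathbb R^{n\times m}$, let $Q,R,M,\tilde R$ be real matrices such that $W=\begin{bmatrix}Q&M\\M^\top&R\end{bmatrix}$ and $\tilde R$ are symmetric positive definite, and let $x_r,\hat x\in\mathbb R^n$, $u_{-1}\in\mathbb R^m$ (constant reference, current state, previously applied control). The LQR tracking problem with a control-rate penalty is to minimize, over sequences $(x_k)_{k\ge0},(u_k)_{k\ge0}$ with $x_0=\hat x$ and $x_{k+1}=Ax_k+Bu_k$ for all $k\ge 0$, the cost $$J_\infty(x,u)=\sum_{k=0}^{\infty}\ell_k,\qquad \ell_k=\|x_r-x_k\|_Q^2+\|u_k\|_R^2+2(x_k-x_r)^\top M u_k+\|u_k-u_{k-1}\|_{\tilde R}^2 ,$$ where $\|v\|_S^2=v^\top S v$; put $J_\infty(x,u)=+\infty$ if the initial condition or the dynamics fail. For a positive semidefinite covariance $S$ let $\|v\|^2_{S^{-1}}=w^\top S w$ for any $w$ with $Sw=v$, and $+\infty$ if there is no such $w$ (this is $v^\top S^{-1}v$ if $S$ is invertible). On the augmented state $\chi_k=(x_k,u_k)$ put $\Phi=\begin{bmatrix}A&B\\0&I\end{bmatrix}$,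 $H=I$, $z_k=(x_r,0)$, $\hat\chi_0=(\hat x,u_{-1})$, $\grave R=W^{-1}$. For a process covariance $S$ and initial covariance $P_0=S$, the Rauch–Tung–Striebel smoother objective with horizon $N$ is $$J_N^{S}(\chi_0,\dots,\chi_N)=\|\chi_0-\hat\chi_0\|_{S^{-1}}^2+\sum_{k=0}^{N}\|z_k-H\chi_k\|_{\grave R^{-1}}^2+\sum_{k=0}^{N-1}\|\chi_{k+1}-\Phi\chi_k\|_{S^{-1}}^2 .$$ Let $\grave Q=\mathrm{diag}(0,\tilde R^{-1})$ and, for $\beta>0$, $\grave Q_\beta=\mathrm{diag}(\beta I,\tilde R)^{-1}$. Then: 1. For every $N$, $J_N^{\grave Q}(\chi_0,\dots,\chi_N)=\sum_{k=0}^N\ell_k$ if $x_0=\hat x$ and $x_{k+1}=Ax_k+Bu_k$ for all $0\le k<N$, and $J_N^{\grave Q}=+\infty$ otherwise. 2. For all sequences $(x_k),(u_k)$, $J_N^{\grave Q}(\chi_0,\dots,\chi_N)\to J_\infty(x,u)$ in $[0,\infty]$ as $N\to\infty$. 3. $\inf J_N^{\grave Q}\to\inf J_\infty$ in $[0,\infty]$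 as $N\to\infty$. Each $J_N^{\grave Q}$ has a unique minimizer $\chi^{N}$. If $\inf J_\infty<\infty$, then $J_\infty$ has a unique minimizer $(x^*,u^*)$ and, for every $k$, $\chi^{N}_k\to(x^*_k,u^*_k)$ as $N\to\infty$; in particular the first controls converge to $u_0^*$. 4. The zero block is the limit of a penalty on dynamics errors: as $\beta\to\infty$, $\grave Q_\beta\to\grave Q$, and for every $N$, $J_N^{\grave Q_\beta}\to J_N^{\grave Q}$ pointwise in $[0,\infty]$, $\inf J_N^{\grave Q_\beta}\to\inf J_N^{\grave Q}$, and the minimizer of $J_N^{\grave Q_\beta}$ (which exists and is unique for every $\beta>0$) converges to $\chi^{N}$. -/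

import Mathlib

open Set Filter Topology Matrix
open scoped ENNReal

noncomputable section

/-- The squared norm `‖v‖²_{S⁻¹}` attached to a covariance matrix `S` (symmetric, positive
semidefinite, possibly singular): `wᵀ S w` for any solution `w` of `S w = v`, and `+∞` when there is
none. If `S` is invertible this is `vᵀ S⁻¹ v`; if `S` is singular, a deviation `v` outside the range
of `S` is infinitely penalized. -/
def covNormSq {ι : Type*} [Fintype ι] (S : Matrix ι ι ℝ) (v : ι → ℝ) : ℝ≥0∞ :=
  ⨅ (w : ι → ℝ) (_ : S *ᵥ w = v), ENNReal.ofReal (w ⬝ᵥ (S *ᵥ w))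

/-- The objective minimized by the Rauch–Tung–Striebel smoother over a horizon of length `N`, for the
model `χ_{k+1} = Φ χ_k + w`, `z_k = H χ_k + v` with initial estimate `χhat₀`, initial covariance `P₀`,
process covariance `Q` and measurement covariance `R`. -/
def smootherObjective {ι κ : Type*} [Fintype ι] [Fintype κ]
    (Φ : Matrix ι ι ℝ) (H : Matrix κ ι ℝ) (P₀ Q : Matrix ι ι ℝ) (R : Matrix κ κ ℝ)
    (χhat₀ : ι → ℝ) (z : ℕ → κ → ℝ) (N : ℕ) (χ : Fin (N + 1) → ι → ℝ) : ℝ≥0∞ :=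
  covNormSq P₀ (χ 0 - χhat₀)
    + ∑ k : Fin (N + 1), covNormSq R (z k - H *ᵥ χ k)
    + ∑ k : Fin N, covNormSq Q (χ k.succ - Φ *ᵥ χ k.castSucc)

/-- The data of a discrete-time linear-quadratic tracking problem with `n` states, `m` controls and a
constant reference. -/
structure LQRData (n m : ℕ) where
  /-- state matrix -/
  A : Matrix (Fin n) (Fin n) ℝ
  /-- control matrix -/
  B : Matrix (Fin n) (Fin m) ℝ
  /-- weight on the state error -/
  Q : Matrix (Fin n) (Fin n) ℝ
  /-- weight on the control -/
  R : Matrix (Fin m) (Fin m) ℝ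
  /-- state-control coupling weight -/
  M : Matrix (Fin n) (Fin m) ℝ
  /-- weight on the control rate -/
  Rrate : Matrix (Fin m) (Fin m) ℝ
  /-- constant reference -/
  xref : Fin n → ℝ
  /-- current state -/
  xinit : Fin n → ℝ
  /-- previously applied control, playing the role of `u_{-1}` -/
  ulast : Fin m → ℝ

namespace LQRData

variable {n m : ℕ} (P : LQRData n m)

/-! ### The LQR problem -/

/-- The control preceding `u k`; it is the previously applied control for `k = 0`. -/
def prevControl (u : ℕ → Fin m → ℝ) : ℕ → Fin m → ℝ
  | 0 => P.ulast
  | k + 1 => u k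

/-- The stage cost
`‖x_r - x_k‖²_Q + ‖u_k‖²_R + 2 (x_k - x_r)ᵀ M u_k + ‖u_k - u_{k-1}‖²_{Rrate}`. -/
def stageCost (x : ℕ → Fin n → ℝ) (u : ℕ → Fin m → ℝ) (k : ℕ) : ℝ :=
  (P.xref - x k) ⬝ᵥ (P.Q *ᵥ (P.xref - x k)) + u k ⬝ᵥ (P.R *ᵥ u k)
    + 2 * ((x k - P.xref) ⬝ᵥ (P.M *ᵥ u k))
    + (u k - P.prevControl u k) ⬝ᵥ (P.Rrate *ᵥ (u k - P.prevControl u k))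

open Classical in
/-- The LQR problem truncated to the stages `0, …, N`, as an extended-valued objective: the sum of the
stage costs if the initial condition and the dynamics hold up to time `N`, and `+∞` otherwise. -/
def lqrObjectiveUpTo (N : ℕ) (x : ℕ → Fin n → ℝ) (u : ℕ → Fin m → ℝ) : ℝ≥0∞ :=
  if x 0 = P.xinit ∧ ∀ k < N, x (k + 1) = P.A *ᵥ x k + P.B *ᵥ u k then
    ∑ k ∈ Finset.range (N + 1), ENNReal.ofReal (P.stageCost x u k)
  else ⊤

open Classical in
/-- The infinite-horizon LQR problem as an extended-valued objective: the infinite sum of the stage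
costs if the initial condition and the dynamics hold, and `+∞` otherwise. -/
def lqrObjective (x : ℕ → Fin n → ℝ) (u : ℕ → Fin m → ℝ) : ℝ≥0∞ :=
  if x 0 = P.xinit ∧ ∀ k, x (k + 1) = P.A *ᵥ x k + P.B *ᵥ u k then
    ∑' k, ENNReal.ofReal (P.stageCost x u k)
  else ⊤

/-! ### The smoother on the augmented state `(x, u)` -/

/-- The block weight `[[Q, M], [Mᵀ, R]]`. -/
def weight : Matrix (Fin n ⊕ Fin m) (Fin n ⊕ Fin m) ℝ :=
  fromBlocks P.Q P.M P.Mᵀ P.R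

/-- The augmented transition matrix `Φ = [[A, B], [0, I]]`. -/
def transition : Matrix (Fin n ⊕ Fin m) (Fin n ⊕ Fin m) ℝ :=
  fromBlocks P.A P.B 0 1

/-- The measurement covariance: the inverse of the block weight. -/
def measCov : Matrix (Fin n ⊕ Fin m) (Fin n ⊕ Fin m) ℝ :=
  P.weight⁻¹

/-- The process covariance `diag(0, Rrate⁻¹)`. -/
def procCov : Matrix (Fin n ⊕ Fin m) (Fin n ⊕ Fin m) ℝ :=
  fromBlocks 0 0 0 P.Rrate⁻¹

/-- The process covariance `diag(β I, Rrate)⁻¹`, for which dynamics errors are penalized with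
weight `β`. -/
def procCovPenalty (β : ℝ) : Matrix (Fin n ⊕ Fin m) (Fin n ⊕ Fin m) ℝ :=
  (fromBlocks (β • (1 : Matrix (Fin n) (Fin n) ℝ)) 0 0 P.Rrate)⁻¹

/-- The smoother objective of the augmented system with full measurement `H = I`, constant
measurement `z_k = (x_r, 0)`, initial estimate `(xinit, ulast)`, measurement covariance `measCov` and
initial and process covariances both equal to `S`. -/
def ocObjective (S : Matrix (Fin n ⊕ Fin m) (Fin n ⊕ Fin m) ℝ) (N : ℕ)
    (χ : Fin (N + 1) → Fin n ⊕ Fin m → ℝ) : ℝ≥0∞ :=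
  smootherObjective P.transition (1 : Matrix (Fin n ⊕ Fin m) (Fin n ⊕ Fin m) ℝ) S S P.measCov
    (Sum.elim P.xinit P.ulast) (fun _ => Sum.elim P.xref 0) N χ

end LQRData

end

/-! Both limits, `β → ∞` and `N → ∞`, are increasing limits of lower semicontinuous functions that
are strongly midpoint convex in each coordinate `χ_k`, with one modulus `c`. That modulus comes from
the measurement terms alone: `H = 1` and `W` is positive definite, so it depends on neither `N` nor
`β`.

For such a family `F i`, take near-minimizers `x i`, let `v i` be the infima and `s` their supremum.
If `i ≤ j`, then `x j` is nearly optimal for `F i` up to `s - v i`, so convexity at the midpoint of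
`x i` and `x j` makes each coordinate Cauchy when `s` is finite. Lower semicontinuity bounds every
`F i` at the limit by `s`; hence the limit minimizes the pointwise limit `G`, and `inf G = s`
(`exists_tendsto_of_almost_minimizers`, `exists_tendsto_of_minimizers`). A constant family gives
existence of minimizers. No compactness or stabilizability is needed.

The singular covariance inherits convexity and semicontinuity from `β → ∞`. `ocObjective_procCov`
then identifies the smoother with truncated LQR, whose limit in `N` is the infinite-horizon problem.
Convexity is stated coordinatewise so that it makes sense on infinite sequences with the product
topology. -/

/-! ### Increasing limits of strongly midpoint-convex functions. -/

section Abstract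

variable {κ V : Type*} [NormedAddCommGroup V] [NormedSpace ℝ V]

/-- Midpoint convexity of `F` with modulus `c ‖·‖²` in the coordinate `k`. -/
def StronglyMidconvexAt (c : ℝ) (k : κ) (F : (κ → V) → ℝ≥0∞) : Prop :=
  ∀ a b, 2 * F ((1 / 2 : ℝ) • (a + b)) + ENNReal.ofReal (c * ‖a k - b k‖ ^ 2) ≤ F a + F b

theorem StronglyMidconvexAt.of_tendsto {ι : Type*} {l : Filter ι} [l.NeBot] {c : ℝ} {k : κ}
    {F : ι → (κ → V) → ℝ≥0∞} {G : (κ → V) → ℝ≥0∞}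
    (hF : ∀ᶠ i in l, StronglyMidconvexAt c k (F i))
    (hFG : ∀ a, Tendsto (fun i => F i a) l (𝓝 (G a))) : StronglyMidconvexAt c k G := by
  intro a b
  refine le_of_tendsto_of_tendsto
    ((ENNReal.Tendsto.const_mul (hFG _) (Or.inr ENNReal.ofNat_ne_top)).add tendsto_const_nhds)
    ((hFG a).add (hFG b)) ?_
  filter_upwards [hF] with i hi using hi a b

/-- The midpoint costs at least `v`, so the excesses `s` and `t` must pay for the distance term; `v
≠ ⊤` allows `2 * v` to be cancelled. -/
theorem StronglyMidconvexAt.ofReal_le {c : ℝ} {k : κ} {F : (κ → V) → ℝ≥0∞}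
    (hF : StronglyMidconvexAt c k F) {v s t : ℝ≥0∞} (hv : v ≠ ⊤) {a b : κ → V}
    (hmin : ∀ y, v ≤ F y) (ha : F a ≤ v + s) (hb : F b ≤ v + t) :
    ENNReal.ofReal (c * ‖a k - b k‖ ^ 2) ≤ s + t := by
  have h : 2 * v + ENNReal.ofReal (c * ‖a k - b k‖ ^ 2) ≤ 2 * v + (s + t) :=
    calc _ ≤ 2 * F ((1 / 2 : ℝ) • (a + b)) + ENNReal.ofReal (c * ‖a k - b k‖ ^ 2) := by
          gcongr; exact hmin _
      _ ≤ F a + F b := hF a b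
      _ ≤ (v + s) + (v + t) := add_le_add ha hb
      _ = _ := by ring
  exact (ENNReal.add_le_add_iff_left (ENNReal.mul_ne_top ENNReal.ofNat_ne_top hv)).1 h

theorem eq_of_isMinOn_of_stronglyMidconvexAt {c : ℝ} (hc : 0 < c) {F : (κ → V) → ℝ≥0∞}
    (hF : ∀ k, StronglyMidconvexAt c k F) {a b : κ → V} (ha : ∀ y, F a ≤ F y)
    (hb : F b ≤ F a) (hfin : F a ≠ ⊤) : a = b := by
  funext k
  have h := (hF k).ofReal_le hfin (s := 0) (t := 0) (a := a) (b := b) ha (by simp)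
    (by simpa using hb)
  rw [add_zero, nonpos_iff_eq_zero, ENNReal.ofReal_eq_zero] at h
  have h0 : ‖a k - b k‖ ^ 2 ≤ 0 := by
    by_contra! h'
    exact absurd h (not_le.2 (mul_pos hc h'))
  have h1 : ‖a k - b k‖ = 0 := by
    have := sq_nonneg ‖a k - b k‖
    exact pow_eq_zero_iff (two_ne_zero) |>.1 (le_antisymm h0 this)
  exact sub_eq_zero.1 (norm_eq_zero.1 h1)

variable [CompleteSpace V] {ι : Type*} [Nonempty ι] [LinearOrder ι]

/-- Approximate minimizers of an increasing family of strongly convex functions converge to a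
point at which the supremum of the family is at most the limit of the optimal values. -/
theorem exists_tendsto_of_almost_minimizers {c : ℝ} (hc : 0 < c) {F : ι → (κ → V) → ℝ≥0∞}
    (hmono : Monotone F) (hlsc : ∀ i, LowerSemicontinuous (F i))
    (hconv : ∀ k, ∀ᶠ i in atTop, StronglyMidconvexAt c k (F i))
    {x : ι → κ → V} {ε : ι → ℝ≥0∞} (hε : Tendsto ε atTop (𝓝 0))
    (hx : ∀ i, F i (x i) ≤ (⨅ y, F i y) + ε i) (hfin : ⨆ i, ⨅ y, F i y ≠ ⊤) :
    ∃ a, Tendsto x atTop (𝓝 a) ∧ ∀ i, F i a ≤ ⨆ i, ⨅ y, F i y := by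
  set v : ι → ℝ≥0∞ := fun i => ⨅ y, F i y with hv
  have vmono : Monotone v := fun i j hij => iInf_mono fun y => hmono hij y
  have vlim : Tendsto v atTop (𝓝 (⨆ i, v i)) := tendsto_atTop_iSup vmono
  set s := ⨆ i, v i with hs
  have vle : ∀ i, v i ≤ s := fun i => le_iSup v i
  have gap : Tendsto (fun i => s - v i) atTop (𝓝 0) := by
    have := ENNReal.Tendsto.sub (tendsto_const_nhds (x := s)) vlim (Or.inl hfin)
    simpa using this
  have cauchy : ∀ k, CauchySeq fun i => x i k := by
    intro k
    rw [Metric.cauchySeq_iff]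
    intro δ hδ
    have hpos : 0 < ENNReal.ofReal (c * δ ^ 2) / 3 := by
      refine ENNReal.div_pos ?_ (by simp)
      simpa using by positivity
    have h1 := hε.eventually_lt_const hpos
    have h2 := gap.eventually_lt_const hpos
    obtain ⟨i₀, hi₀⟩ := eventually_atTop.1 ((h1.and h2).and (hconv k))
    -- Both points are compared under the smaller function: `F i (x j) ≤ F j (x j) ≤ s + ε j`. The
    -- three errors `ε i`, `s - v i`, `ε j` each take a third of `c * δ ^ 2`.
    have key : ∀ i ≥ i₀, ∀ j ≥ i, ‖x i k - x j k‖ < δ := by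
      intro i hi j hij
      obtain ⟨⟨h1, h2⟩, h3⟩ := hi₀ i hi
      obtain ⟨⟨h1', -⟩, -⟩ := hi₀ j (hi.trans hij)
      have h := h3.ofReal_le (v := v i) (s := ε i) (t := (s - v i) + ε j)
        (ne_top_of_le_ne_top hfin (vle i)) (a := x i) (b := x j) (fun y => iInf_le _ y) (hx i)
        (by
          rw [← add_assoc, add_tsub_cancel_of_le (vle i)]
          exact (hmono hij _).trans ((hx j).trans (add_le_add (vle j) le_rfl)))
      have h' : ENNReal.ofReal (c * ‖x i k - x j k‖ ^ 2) < ENNReal.ofReal (c * δ ^ 2) := by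
        refine h.trans_lt ((ENNReal.add_lt_add h1 (ENNReal.add_lt_add h2 h1')).trans_eq ?_)
        rw [← add_assoc, ENNReal.add_thirds]
      have h'' := (ENNReal.ofReal_lt_ofReal_iff (by positivity)).1 h'
      exact lt_of_pow_lt_pow_left₀ 2 hδ.le (lt_of_mul_lt_mul_left h'' hc.le)
    refine ⟨i₀, fun i hi j hj => ?_⟩
    rcases le_total i j with hij | hij
    · rw [dist_eq_norm]; exact key i hi j hij
    · rw [dist_comm, dist_eq_norm]; exact key j hj i hij
  choose a ha using fun k => cauchySeq_tendsto_of_complete (cauchy k)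
  have hxa : Tendsto x atTop (𝓝 a) := tendsto_pi_nhds.2 ha
  refine ⟨a, hxa, fun i => ?_⟩
  -- Any `r' < F i a` stays below `F i (x j) ≤ s + ε j` for large `j`. Letting `ε j → 0` gives only
  -- `r' ≤ s`, so `r'` is interposed to keep `r < s` strict.
  refine le_of_forall_lt fun r hr => ?_
  obtain ⟨r', hr, hr'⟩ := exists_between hr
  refine hr.trans_le ?_
  have hev : ∀ᶠ j in atTop, r' ≤ s + ε j := by
    filter_upwards [hxa.eventually (hlsc i a r' hr'), eventually_ge_atTop i] with j hj hij
    exact (hj.le.trans (hmono hij _)).trans ((hx j).trans (add_le_add (vle j) le_rfl))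
  exact ge_of_tendsto (by simpa using (tendsto_const_nhds (x := s)).add hε) hev

theorem existsUnique_isMinOn_of_stronglyMidconvexAt {c : ℝ} (hc : 0 < c)
    {F : (κ → V) → ℝ≥0∞} (hlsc : LowerSemicontinuous F)
    (hF : ∀ k, StronglyMidconvexAt c k F) (hfin : ∃ y, F y ≠ ⊤) :
    ∃! a, IsMinOn F univ a := by
  have hv : ⨅ y, F y ≠ ⊤ := by
    obtain ⟨y, hy⟩ := hfin
    exact ne_top_of_le_ne_top hy (iInf_le _ y)
  -- At `i = 0` the slack is `⊤`, which is harmless.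
  have hx : ∀ i : ℕ, ∃ x, F x ≤ (⨅ y, F y) + ((i : ℝ≥0∞))⁻¹ := by
    intro i
    have : (⨅ y, F y) < (⨅ y, F y) + ((i : ℝ≥0∞))⁻¹ := ENNReal.lt_add_right hv (by simp)
    obtain ⟨x, hx⟩ := iInf_lt_iff.1 this
    exact ⟨x, hx.le⟩
  choose x hx using hx
  obtain ⟨a, -, ha⟩ := exists_tendsto_of_almost_minimizers (F := fun _ : ℕ => F) hc
    monotone_const (fun _ => hlsc) (fun k => Eventually.of_forall fun _ => hF k)
    ENNReal.tendsto_inv_nat_nhds_zero hx (by simpa using hv)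
  have hle : ∀ y, F a ≤ F y := fun y => (ha 0).trans (by simpa using iInf_le F y)
  refine ⟨a, fun y _ => hle y, fun b hb => ?_⟩
  obtain ⟨y, hy⟩ := hfin
  exact (eq_of_isMinOn_of_stronglyMidconvexAt hc hF hle (hb (mem_univ a))
    (ne_top_of_le_ne_top hy (hle y))).symm

/-- Optimal values and minimizers of an increasing sequence of strongly convex functions with
pointwise limit `G`. -/
theorem exists_tendsto_of_minimizers {c : ℝ} (hc : 0 < c) {F : ι → (κ → V) → ℝ≥0∞}
    {G : (κ → V) → ℝ≥0∞} (hmono : Monotone F) (hlsc : ∀ i, LowerSemicontinuous (F i))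
    (hconv : ∀ k, ∀ᶠ i in atTop, StronglyMidconvexAt c k (F i))
    (hFG : ∀ a, Tendsto (fun i => F i a) atTop (𝓝 (G a)))
    {x : ι → κ → V} (hx : ∀ i y, F i (x i) ≤ F i y) :
    Tendsto (fun i => ⨅ y, F i y) atTop (𝓝 (⨅ y, G y)) ∧
      ((∃ y, G y ≠ ⊤) → ∃ a, Tendsto x atTop (𝓝 a) ∧ ∀ y, G a ≤ G y) := by
  have vmono : Monotone fun i => ⨅ y, F i y := fun i j hij => iInf_mono fun y => hmono hij y
  have hle : ∀ i y, F i y ≤ G y := fun i y =>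
    Monotone.ge_of_tendsto (fun i j hij => hmono hij y) (hFG y) i
  have hsle : ⨆ i, ⨅ y, F i y ≤ ⨅ y, G y := iSup_le fun i => iInf_mono (hle i)
  have key : ⨆ i, ⨅ y, F i y ≠ ⊤ →
      ∃ a, Tendsto x atTop (𝓝 a) ∧ G a ≤ ⨆ i, ⨅ y, F i y := by
    intro h
    obtain ⟨a, ha, ha'⟩ := exists_tendsto_of_almost_minimizers (x := x) (ε := fun _ => 0) hc
      hmono hlsc hconv tendsto_const_nhds (fun i => by simpa using hx i) h
    exact ⟨a, ha, le_of_tendsto' (hFG a) ha'⟩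
  constructor
  · have : ⨆ i, ⨅ y, F i y = ⨅ y, G y := by
      refine le_antisymm hsle ?_
      by_cases h : ⨆ i, ⨅ y, F i y = ⊤
      · simp [h]
      · obtain ⟨a, -, ha⟩ := key h
        exact (iInf_le _ a).trans ha
    exact this ▸ tendsto_atTop_iSup vmono
  · rintro ⟨y, hy⟩
    obtain ⟨a, ha, ha'⟩ := key
      (ne_top_of_le_ne_top (ne_top_of_le_ne_top hy (iInf_le _ y)) hsle)
    exact ⟨a, ha, fun y => (ha'.trans hsle).trans (iInf_le _ y)⟩

end Abstract

/-! ### Quadratic forms, covariance norms and convexity of the smoother objective. -/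

section QuadraticForms

variable {ι κ : Type*} [Fintype ι] [Fintype κ]

/-- Parallelogram identity; the cross terms cancel without symmetry of `S`. -/
theorem two_mul_half_add_quadForm (S : Matrix ι ι ℝ) (a b : ι → ℝ) :
    2 * (((1 / 2 : ℝ) • (a + b)) ⬝ᵥ (S *ᵥ ((1 / 2 : ℝ) • (a + b))))
      + 1 / 2 * ((a - b) ⬝ᵥ (S *ᵥ (a - b))) = a ⬝ᵥ (S *ᵥ a) + b ⬝ᵥ (S *ᵥ b) := by
  simp only [mulVec_smul, mulVec_add, mulVec_sub, dotProduct_add, add_dotProduct, sub_dotProduct,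
    dotProduct_sub, smul_dotProduct, dotProduct_smul, smul_eq_mul]
  ring

theorem Matrix.PosDef.quadForm_nonneg {S : Matrix ι ι ℝ} (hS : S.PosDef) (v : ι → ℝ) :
    0 ≤ v ⬝ᵥ (S *ᵥ v) := by
  simpa using hS.posSemidef.dotProduct_mulVec_nonneg v

theorem Matrix.PosDef.exists_le_quadForm {S : Matrix ι ι ℝ} (hS : S.PosDef) :
    ∃ c > 0, ∀ v : ι → ℝ, c * ‖v‖ ^ 2 ≤ v ⬝ᵥ (S *ᵥ v) := by
  have hcont : Continuous fun v : ι → ℝ => v ⬝ᵥ (S *ᵥ v) := by fun_prop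
  have hpos : ∀ v : ι → ℝ, v ≠ 0 → 0 < v ⬝ᵥ (S *ᵥ v) := fun v hv => by
    simpa using hS.dotProduct_mulVec_pos hv
  obtain ⟨c, hc, hcs⟩ : ∃ c > 0, ∀ v ∈ Metric.sphere (0 : ι → ℝ) 1, c ≤ v ⬝ᵥ (S *ᵥ v) := by
    -- The sphere is empty when `ι` is, and then any constant serves; otherwise compactness gives a
    -- positive minimum, extended by homogeneity.
    rcases (Metric.sphere (0 : ι → ℝ) 1).eq_empty_or_nonempty with h | h
    · exact ⟨1, one_pos, by simp [h]⟩
    · obtain ⟨w, hw, hmin⟩ := (isCompact_sphere (0 : ι → ℝ) 1).exists_isMinOn h hcont.continuousOn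
      refine ⟨_, hpos w ?_, fun v hv => hmin hv⟩
      rintro rfl
      simp at hw
  refine ⟨c, hc, fun v => ?_⟩
  rcases eq_or_ne v 0 with rfl | hv
  · simp
  · have hn : 0 < ‖v‖ := norm_pos_iff.2 hv
    have h := hcs (‖v‖⁻¹ • v) (by simp [norm_smul, hn.ne'])
    rw [mulVec_smul, smul_dotProduct, dotProduct_smul, smul_eq_mul, smul_eq_mul] at h
    calc c * ‖v‖ ^ 2 ≤ ‖v‖⁻¹ * (‖v‖⁻¹ * (v ⬝ᵥ (S *ᵥ v))) * ‖v‖ ^ 2 := by gcongr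
      _ = _ := by field_simp

theorem covNormSq_inv [DecidableEq ι] {S : Matrix ι ι ℝ} (hS : IsUnit S.det) (v : ι → ℝ) :
    covNormSq S⁻¹ v = ENNReal.ofReal (v ⬝ᵥ (S *ᵥ v)) := by
  have hw : S⁻¹ *ᵥ (S *ᵥ v) = v := by rw [mulVec_mulVec, nonsing_inv_mul _ hS, one_mulVec]
  refine le_antisymm ((iInf₂_le (S *ᵥ v) hw).trans_eq ?_) (le_iInf₂ fun w h => ?_)
  · rw [hw, dotProduct_comm]
  · subst h
    rw [mulVec_mulVec, mul_nonsing_inv _ hS, one_mulVec, dotProduct_comm]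

/-- Midpoint convexity of `‖·‖²_{S⁻¹}` with modulus `c ‖·‖²`. -/
def CovMidconvex (c : ℝ) (S : Matrix ι ι ℝ) : Prop :=
  ∀ a b, 2 * covNormSq S ((1 / 2 : ℝ) • (a + b)) + ENNReal.ofReal (c * ‖a - b‖ ^ 2)
    ≤ covNormSq S a + covNormSq S b

theorem covMidconvex_inv [DecidableEq ι] {S : Matrix ι ι ℝ} (hS : IsUnit S.det) {c : ℝ}
    (hc : 0 ≤ c) (h : ∀ v : ι → ℝ, c * ‖v‖ ^ 2 ≤ v ⬝ᵥ (S *ᵥ v)) : CovMidconvex (c / 2) S⁻¹ := by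
  intro a b
  have hn : ∀ v : ι → ℝ, 0 ≤ v ⬝ᵥ (S *ᵥ v) := fun v => le_trans (by positivity) (h v)
  simp only [covNormSq_inv hS]
  rw [← ENNReal.ofReal_add (hn a) (hn b), ← two_mul_half_add_quadForm S a b,
    ENNReal.ofReal_add (mul_nonneg zero_le_two (hn _)) (mul_nonneg (by norm_num) (hn _)),
    ENNReal.ofReal_mul zero_le_two, ENNReal.ofReal_ofNat]
  refine add_le_add le_rfl (ENNReal.ofReal_le_ofReal ?_)
  linarith [h (a - b)]

/-- With `H = 1` the `k`-th measurement residual sees `χ_k` itself and supplies the whole modulus;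
the other terms need only plain convexity, being covariance norms of affine functions of `χ`. -/
theorem stronglyMidconvexAt_smootherObjective [DecidableEq ι] {c : ℝ} {Φ P₀ Q R : Matrix ι ι ℝ}
    (hP₀ : CovMidconvex 0 P₀) (hQ : CovMidconvex 0 Q) (hR : CovMidconvex c R)
    (χhat : ι → ℝ) (z : ℕ → ι → ℝ) (N : ℕ) (k : Fin (N + 1)) :
    StronglyMidconvexAt c k (smootherObjective Φ 1 P₀ Q R χhat z N) := by
  intro a b
  simp only [CovMidconvex, zero_mul, ENNReal.ofReal_zero, add_zero] at hP₀ hQ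
  simp only [smootherObjective, mul_add, Finset.mul_sum]
  have h0 := hP₀ (a 0 - χhat) (b 0 - χhat)
  -- The modulus is kept only in the summand `j = k` and discarded elsewhere.
  have h1 : ∀ j : Fin (N + 1), 2 * covNormSq R (z j - 1 *ᵥ ((1 / 2 : ℝ) • (a + b)) j)
      + (if j = k then ENNReal.ofReal (c * ‖a j - b j‖ ^ 2) else 0)
      ≤ covNormSq R (z j - 1 *ᵥ a j) + covNormSq R (z j - 1 *ᵥ b j) := by
    intro j
    refine le_trans ?_ (hR (z j - 1 *ᵥ a j) (z j - 1 *ᵥ b j))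
    have e1 : z j - 1 *ᵥ ((1 / 2 : ℝ) • (a + b)) j
        = (1 / 2 : ℝ) • ((z j - 1 *ᵥ a j) + (z j - 1 *ᵥ b j)) := by
      simp only [one_mulVec, Pi.smul_apply, Pi.add_apply]; module
    have e2 : ‖(z j - 1 *ᵥ a j) - (z j - 1 *ᵥ b j)‖ = ‖a j - b j‖ := by
      rw [norm_sub_rev]; simp
    rw [e1, e2]
    gcongr
    split_ifs <;> simp
  have h2 : ∀ j : Fin N, 2 * covNormSq Q (((1 / 2 : ℝ) • (a + b)) j.succ
        - Φ *ᵥ ((1 / 2 : ℝ) • (a + b)) j.castSucc)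
      ≤ covNormSq Q (a j.succ - Φ *ᵥ a j.castSucc) + covNormSq Q (b j.succ - Φ *ᵥ b j.castSucc) := by
    intro j
    refine le_trans (le_of_eq ?_) (hQ _ _)
    congr 2
    simp only [Pi.smul_apply, Pi.add_apply, mulVec_smul, mulVec_add]; module
  have e0 : ((1 / 2 : ℝ) • (a + b)) 0 - χhat = (1 / 2 : ℝ) • ((a 0 - χhat) + (b 0 - χhat)) := by
    simp only [Pi.smul_apply, Pi.add_apply]; module
  rw [e0]
  have s1 := Finset.sum_le_sum fun j (_ : j ∈ Finset.univ) => h1 j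
  have s2 := Finset.sum_le_sum fun j (_ : j ∈ Finset.univ) => h2 j
  rw [Finset.sum_add_distrib, Finset.sum_add_distrib, Finset.sum_ite_eq' Finset.univ k,
    if_pos (Finset.mem_univ k)] at s1
  rw [Finset.sum_add_distrib] at s2
  convert add_le_add (add_le_add h0 s1) s2 using 1 <;> ac_rfl

theorem continuous_smootherObjective {Φ P₀ Q : Matrix ι ι ℝ} {H : Matrix κ ι ℝ}
    {R : Matrix κ κ ℝ} (hP₀ : Continuous (covNormSq P₀)) (hQ : Continuous (covNormSq Q))
    (hR : Continuous (covNormSq R)) (χhat : ι → ℝ) (z : ℕ → κ → ℝ) (N : ℕ) :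
    Continuous (smootherObjective Φ H P₀ Q R χhat z N) := by
  unfold smootherObjective
  refine (Continuous.add (hP₀.comp (by fun_prop)) ?_).add ?_
  · exact continuous_finsetSum _ fun k _ => hR.comp (by fun_prop)
  · exact continuous_finsetSum _ fun k _ => hQ.comp (by fun_prop)

theorem continuous_covNormSq_inv [DecidableEq ι] {S : Matrix ι ι ℝ} (hS : IsUnit S.det) :
    Continuous (covNormSq S⁻¹) := by
  rw [funext (covNormSq_inv hS)]
  exact ENNReal.continuous_ofReal.comp (by fun_prop)

end QuadraticForms

/-! ### Process and measurement covariances of the augmented system. -/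

namespace LQRData

variable {n m : ℕ} (P : LQRData n m)

theorem isUnit_det_blockPenalty (hRrate : P.Rrate.PosDef) {β : ℝ} (hβ : 0 < β) :
    IsUnit (fromBlocks (β • (1 : Matrix (Fin n) (Fin n) ℝ)) 0 0 P.Rrate).det := by
  rw [det_fromBlocks_zero₁₂, det_smul, det_one, mul_one]
  exact ((pow_pos hβ _).ne'.isUnit).mul ((isUnit_iff_isUnit_det _).1 hRrate.isUnit)

theorem blockPenalty_quadForm (β : ℝ) (v : Fin n ⊕ Fin m → ℝ) :
    v ⬝ᵥ (fromBlocks (β • (1 : Matrix (Fin n) (Fin n) ℝ)) 0 0 P.Rrate *ᵥ v)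
      = β * ((v ∘ Sum.inl) ⬝ᵥ (v ∘ Sum.inl))
        + (v ∘ Sum.inr) ⬝ᵥ (P.Rrate *ᵥ (v ∘ Sum.inr)) := by
  rw [fromBlocks_mulVec, ← Sum.elim_comp_inl_inr v, sumElim_dotProduct_sumElim]
  simp [smul_mulVec]

theorem covNormSq_procCovPenalty (hRrate : P.Rrate.PosDef) {β : ℝ} (hβ : 0 < β)
    (v : Fin n ⊕ Fin m → ℝ) :
    covNormSq (P.procCovPenalty β) v = ENNReal.ofReal (β * ((v ∘ Sum.inl) ⬝ᵥ (v ∘ Sum.inl))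
        + (v ∘ Sum.inr) ⬝ᵥ (P.Rrate *ᵥ (v ∘ Sum.inr))) := by
  rw [procCovPenalty, covNormSq_inv (P.isUnit_det_blockPenalty hRrate hβ), blockPenalty_quadForm]

theorem procCov_mulVec (w : Fin n ⊕ Fin m → ℝ) :
    P.procCov *ᵥ w = Sum.elim (0 : Fin n → ℝ) (P.Rrate⁻¹ *ᵥ (w ∘ Sum.inr)) := by
  rw [procCov, fromBlocks_mulVec]
  simp

theorem covNormSq_procCov_of_ne {v : Fin n ⊕ Fin m → ℝ} (hv : v ∘ Sum.inl ≠ 0) :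
    covNormSq P.procCov v = ⊤ := by
  refine iInf₂_eq_top.2 fun w h => absurd ?_ hv
  rw [← h, procCov_mulVec, Sum.elim_comp_inl]

theorem covNormSq_procCov_of_eq (hRrate : P.Rrate.PosDef) {v : Fin n ⊕ Fin m → ℝ}
    (hv : v ∘ Sum.inl = 0) :
    covNormSq P.procCov v = ENNReal.ofReal ((v ∘ Sum.inr) ⬝ᵥ (P.Rrate *ᵥ (v ∘ Sum.inr))) := by
  have hdet : IsUnit P.Rrate.det := (isUnit_iff_isUnit_det _).1 hRrate.isUnit
  -- Solutions `w` are not unique: the first block is free. It does not affect the value, so it is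
  -- set to zero.
  have hw : P.procCov *ᵥ (Sum.elim 0 (P.Rrate *ᵥ (v ∘ Sum.inr))) = v := by
    rw [procCov_mulVec, Sum.elim_comp_inr, mulVec_mulVec, nonsing_inv_mul _ hdet, one_mulVec, ← hv,
      Sum.elim_comp_inl_inr]
  refine le_antisymm ((iInf₂_le (Sum.elim (0 : Fin n → ℝ) (P.Rrate *ᵥ (v ∘ Sum.inr))) hw).trans_eq ?_)
    (le_iInf₂ fun w h => ?_)
  · rw [hw]
    nth_rw 2 [← Sum.elim_comp_inl_inr v]
    rw [sumElim_dotProduct_sumElim, zero_dotProduct, zero_add, dotProduct_comm]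
  · subst h
    rw [procCov_mulVec, Sum.elim_comp_inr, mulVec_mulVec, mul_nonsing_inv _ hdet, one_mulVec]
    nth_rw 3 [← Sum.elim_comp_inl_inr w]
    rw [sumElim_dotProduct_sumElim, dotProduct_zero, zero_add, dotProduct_comm]

theorem procCovPenalty_eq (hRrate : P.Rrate.PosDef) {β : ℝ} (hβ : 0 < β) :
    P.procCovPenalty β = fromBlocks (β⁻¹ • 1) 0 0 P.Rrate⁻¹ := by
  have hdet : IsUnit P.Rrate.det := (isUnit_iff_isUnit_det _).1 hRrate.isUnit
  refine inv_eq_right_inv ?_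
  rw [fromBlocks_multiply]
  simp [mul_nonsing_inv _ hdet, hβ.ne', smul_smul]

theorem tendsto_procCovPenalty (hRrate : P.Rrate.PosDef) :
    Tendsto P.procCovPenalty atTop (𝓝 P.procCov) := by
  -- In the variable `t = β⁻¹` the covariance extends continuously to `t = 0`, where it is
  -- `procCov`.
  have hcont : Continuous fun t : ℝ =>
      fromBlocks (t • (1 : Matrix (Fin n) (Fin n) ℝ)) 0 0 P.Rrate⁻¹ :=
    Continuous.matrix_fromBlocks (by fun_prop) continuous_const continuous_const continuous_const
  have h := (hcont.tendsto 0).comp tendsto_inv_atTop_zero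
  rw [zero_smul] at h
  refine h.congr' ?_
  filter_upwards [eventually_gt_atTop 0] with β hβ using (P.procCovPenalty_eq hRrate hβ).symm

/-- Either the state block of `v` vanishes and `β` drops out, or its positive squared length times
`β` diverges, matching the value `⊤`. -/
theorem tendsto_covNormSq_procCovPenalty (hRrate : P.Rrate.PosDef) (v : Fin n ⊕ Fin m → ℝ) :
    Tendsto (fun β => covNormSq (P.procCovPenalty β) v) atTop (𝓝 (covNormSq P.procCov v)) := by
  have hev : (fun β => ENNReal.ofReal (β * ((v ∘ Sum.inl) ⬝ᵥ (v ∘ Sum.inl))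
        + (v ∘ Sum.inr) ⬝ᵥ (P.Rrate *ᵥ (v ∘ Sum.inr)))) =ᶠ[atTop]
      fun β => covNormSq (P.procCovPenalty β) v := by
    filter_upwards [eventually_gt_atTop 0] with β hβ
      using (P.covNormSq_procCovPenalty hRrate hβ v).symm
  refine Tendsto.congr' hev ?_
  by_cases hv : v ∘ Sum.inl = 0
  · rw [P.covNormSq_procCov_of_eq hRrate hv]
    simp [hv]
  · rw [P.covNormSq_procCov_of_ne hv]
    have hpos : 0 < (v ∘ Sum.inl) ⬝ᵥ (v ∘ Sum.inl) := by
      simpa using dotProduct_star_self_pos_iff.2 hv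
    exact ENNReal.tendsto_ofReal_atTop.comp
      (tendsto_atTop_add_const_right _ _ (tendsto_id.atTop_mul_const hpos))

theorem covNormSq_procCovPenalty_mono (hRrate : P.Rrate.PosDef) {β γ : ℝ} (hβ : 0 < β)
    (h : β ≤ γ) (v : Fin n ⊕ Fin m → ℝ) :
    covNormSq (P.procCovPenalty β) v ≤ covNormSq (P.procCovPenalty γ) v := by
  rw [P.covNormSq_procCovPenalty hRrate hβ, P.covNormSq_procCovPenalty hRrate (hβ.trans_le h)]
  have : 0 ≤ (v ∘ Sum.inl) ⬝ᵥ (v ∘ Sum.inl) := by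
    simpa using dotProduct_star_self_nonneg (v ∘ Sum.inl)
  gcongr

theorem covMidconvex_procCovPenalty (hRrate : P.Rrate.PosDef) {β : ℝ} (hβ : 0 < β) :
    CovMidconvex 0 (P.procCovPenalty β) := by
  have h := covMidconvex_inv (P.isUnit_det_blockPenalty hRrate hβ) le_rfl fun v => by
    rw [zero_mul, blockPenalty_quadForm]
    have : 0 ≤ (v ∘ Sum.inl) ⬝ᵥ (v ∘ Sum.inl) := by
      simpa using dotProduct_star_self_nonneg (v ∘ Sum.inl)
    exact add_nonneg (mul_nonneg hβ.le this) (hRrate.quadForm_nonneg _)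
  rwa [zero_div] at h

theorem covNormSq_measCov (hW : P.weight.PosDef) (v : Fin n ⊕ Fin m → ℝ) :
    covNormSq P.measCov v = ENNReal.ofReal (v ⬝ᵥ (P.weight *ᵥ v)) :=
  covNormSq_inv ((isUnit_iff_isUnit_det _).1 hW.isUnit) v

/-! ### The smoother as the truncated LQR problem, and its limit in the horizon. -/

theorem stageCost_eq (x : ℕ → Fin n → ℝ) (u : ℕ → Fin m → ℝ) (k : ℕ) :
    P.stageCost x u k = (Sum.elim P.xref 0 - Sum.elim (x k) (u k)) ⬝ᵥ
        (P.weight *ᵥ (Sum.elim P.xref 0 - Sum.elim (x k) (u k)))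
      + (u k - P.prevControl u k) ⬝ᵥ (P.Rrate *ᵥ (u k - P.prevControl u k)) := by
  have h : (Sum.elim P.xref 0 - Sum.elim (x k) (u k) : Fin n ⊕ Fin m → ℝ)
      = Sum.elim (P.xref - x k) (-u k) := by
    ext (i | i) <;> simp
  rw [h, weight, fromBlocks_mulVec, Sum.elim_comp_inl, Sum.elim_comp_inr,
    sumElim_dotProduct_sumElim, stageCost]
  have hT : u k ⬝ᵥ (P.Mᵀ *ᵥ (P.xref - x k)) = (P.xref - x k) ⬝ᵥ (P.M *ᵥ u k) := by
    rw [mulVec_transpose, dotProduct_comm, dotProduct_mulVec]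
  rw [← neg_sub P.xref (x k)]
  simp only [dotProduct_add, mulVec_neg, neg_dotProduct, dotProduct_neg, hT]
  ring

theorem ofReal_stageCost (hW : P.weight.PosDef) (hRrate : P.Rrate.PosDef)
    (x : ℕ → Fin n → ℝ) (u : ℕ → Fin m → ℝ) (k : ℕ) :
    ENNReal.ofReal (P.stageCost x u k)
      = covNormSq P.measCov (Sum.elim P.xref 0 - Sum.elim (x k) (u k))
        + ENNReal.ofReal ((u k - P.prevControl u k) ⬝ᵥ
          (P.Rrate *ᵥ (u k - P.prevControl u k))) := by
  rw [stageCost_eq, covNormSq_measCov P hW,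
    ENNReal.ofReal_add (hW.quadForm_nonneg _) (hRrate.quadForm_nonneg _)]

theorem elim_sub_transition_mulVec (x x' : Fin n → ℝ) (u u' : Fin m → ℝ) :
    Sum.elim x' u' - P.transition *ᵥ Sum.elim x u
      = Sum.elim (x' - (P.A *ᵥ x + P.B *ᵥ u)) (u' - u) := by
  rw [transition, fromBlocks_mulVec]
  ext (i | i) <;> simp

open Classical in
theorem covNormSq_procCov_elim (hRrate : P.Rrate.PosDef) (a : Fin n → ℝ) (b : Fin m → ℝ) :
    covNormSq P.procCov (Sum.elim a b)
      = if a = 0 then ENNReal.ofReal (b ⬝ᵥ (P.Rrate *ᵥ b)) else ⊤ := by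
  split_ifs with h
  · rw [P.covNormSq_procCov_of_eq hRrate (by simpa using h), Sum.elim_comp_inr]
  · exact P.covNormSq_procCov_of_ne (by simpa using h)

/-- The truncated LQR problem is the smoother objective with process covariance
`diag(0, Rrate⁻¹)`. -/
theorem ocObjective_procCov (hW : P.weight.PosDef) (hRrate : P.Rrate.PosDef) (N : ℕ)
    (x : ℕ → Fin n → ℝ) (u : ℕ → Fin m → ℝ) :
    P.ocObjective P.procCov N (fun k => Sum.elim (x k) (u k)) = P.lqrObjectiveUpTo N x u := by
  have h0 : (Sum.elim (x 0) (u 0) - Sum.elim P.xinit P.ulast : Fin n ⊕ Fin m → ℝ)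
      = Sum.elim (x 0 - P.xinit) (u 0 - P.ulast) := by
    ext (i | i) <;> simp
  simp only [ocObjective, smootherObjective, Fin.val_zero, h0, one_mulVec, Fin.val_succ,
    Fin.val_castSucc, elim_sub_transition_mulVec, covNormSq_procCov_elim P hRrate, sub_eq_zero,
    lqrObjectiveUpTo]
  split_ifs with h1 h2 h2
  · simp only [ofReal_stageCost P hW hRrate]
    -- The rate term of stage `0` is the initial-covariance penalty; those of stages `1, …, N` are
    -- the `N` process terms, shifted by one.
    rw [Finset.sum_add_distrib, Finset.sum_range_succ' (fun k => ENNReal.ofReal _), add_comm,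
      ← Fin.sum_univ_eq_sum_range (fun k => covNormSq P.measCov _),
      ← Fin.sum_univ_eq_sum_range (fun k => ENNReal.ofReal _)]
    simp only [h2.2 _ (Fin.is_lt _), if_true, prevControl]
    ac_rfl
  · have : ∃ k < N, x (k + 1) ≠ P.A *ᵥ x k + P.B *ᵥ u k := by
      by_contra! h
      exact h2 ⟨h1, h⟩
    obtain ⟨k, hk, hne⟩ := this
    rw [ENNReal.add_eq_top]
    right
    exact ENNReal.sum_eq_top.2 ⟨⟨k, hk⟩, Finset.mem_univ _, if_neg hne⟩
  · exact absurd h2.1 h1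
  · simp

theorem lqrObjectiveUpTo_mono (x : ℕ → Fin n → ℝ) (u : ℕ → Fin m → ℝ) :
    Monotone fun N => P.lqrObjectiveUpTo N x u := by
  intro N N' h
  simp only [lqrObjectiveUpTo]
  split_ifs with h1 h2 h2
  · exact Finset.sum_le_sum_of_subset (Finset.range_mono (by omega))
  · exact le_top
  · exact absurd ⟨h2.1, fun k hk => h2.2 k (hk.trans_le h)⟩ h1
  · exact le_rfl

theorem tendsto_lqrObjectiveUpTo (x : ℕ → Fin n → ℝ) (u : ℕ → Fin m → ℝ) :
    Tendsto (fun N => P.lqrObjectiveUpTo N x u) atTop (𝓝 (P.lqrObjective x u)) := by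
  unfold lqrObjective
  split_ifs with h
  · have : (fun N => P.lqrObjectiveUpTo N x u)
        = fun N => ∑ k ∈ Finset.range (N + 1), ENNReal.ofReal (P.stageCost x u k) :=
      funext fun N => if_pos ⟨h.1, fun k _ => h.2 k⟩
    rw [this]
    exact (ENNReal.tendsto_nat_tsum _).comp (tendsto_add_atTop_nat 1)
  -- A violated constraint is already seen at a finite horizon, after which the truncated objectives
  -- are all `⊤`.
  · obtain ⟨N₀, hN₀⟩ : ∃ N₀, ¬ (x 0 = P.xinit ∧
        ∀ k < N₀, x (k + 1) = P.A *ᵥ x k + P.B *ᵥ u k) := by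
      by_contra! h'
      exact h ⟨(h' 0).1, fun k => (h' (k + 1)).2 k (Nat.lt_succ_self k)⟩
    refine tendsto_const_nhds.congr' ?_
    filter_upwards [eventually_ge_atTop N₀] with N hN
    exact (if_neg fun h' => hN₀ ⟨h'.1, fun k hk => h'.2 k (hk.trans_le hN)⟩).symm

/-! ### Regularity and convexity in the penalty parameter; existence of minimizers. -/

theorem continuous_ocObjective_procCovPenalty (hW : P.weight.PosDef) (hRrate : P.Rrate.PosDef)
    {β : ℝ} (hβ : 0 < β) (N : ℕ) : Continuous (P.ocObjective (P.procCovPenalty β) N) := by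
  have h : Continuous (covNormSq (P.procCovPenalty β)) := by
    rw [procCovPenalty]
    exact continuous_covNormSq_inv (P.isUnit_det_blockPenalty hRrate hβ)
  have hR : Continuous (covNormSq P.measCov) := by
    rw [measCov]
    exact continuous_covNormSq_inv ((isUnit_iff_isUnit_det _).1 hW.isUnit)
  unfold ocObjective
  exact continuous_smootherObjective h h hR _ _ _

theorem ocObjective_procCovPenalty_mono (hRrate : P.Rrate.PosDef) {β γ : ℝ} (hβ : 0 < β)
    (h : β ≤ γ) (N : ℕ) (χ : Fin (N + 1) → Fin n ⊕ Fin m → ℝ) :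
    P.ocObjective (P.procCovPenalty β) N χ ≤ P.ocObjective (P.procCovPenalty γ) N χ := by
  unfold ocObjective smootherObjective
  gcongr <;> exact P.covNormSq_procCovPenalty_mono hRrate hβ h _

theorem tendsto_ocObjective_procCovPenalty (hRrate : P.Rrate.PosDef) (N : ℕ)
    (χ : Fin (N + 1) → Fin n ⊕ Fin m → ℝ) :
    Tendsto (fun β => P.ocObjective (P.procCovPenalty β) N χ) atTop
      (𝓝 (P.ocObjective P.procCov N χ)) := by
  unfold ocObjective smootherObjective
  refine ((P.tendsto_covNormSq_procCovPenalty hRrate _).add tendsto_const_nhds).add ?_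
  exact tendsto_finsetSum _ fun k _ => P.tendsto_covNormSq_procCovPenalty hRrate _

/-- An increasing limit of continuous functions is their supremum. Using `max β 1` keeps the penalty
positive while the index ranges over all of `ℝ`. -/
theorem lowerSemicontinuous_ocObjective (hW : P.weight.PosDef) (hRrate : P.Rrate.PosDef) (N : ℕ) :
    LowerSemicontinuous (P.ocObjective P.procCov N) := by
  have h : P.ocObjective P.procCov N
      = fun χ => ⨆ β : ℝ, P.ocObjective (P.procCovPenalty (max β 1)) N χ := by
    funext χ
    refine tendsto_nhds_unique ((P.tendsto_ocObjective_procCovPenalty hRrate N χ).congr' ?_)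
      (tendsto_atTop_iSup fun β γ h => P.ocObjective_procCovPenalty_mono hRrate
        (by positivity) (max_le_max h le_rfl) N χ)
    filter_upwards [eventually_ge_atTop 1] with β hβ
    rw [max_eq_left hβ]
  rw [h]
  exact lowerSemicontinuous_iSup fun β =>
    (P.continuous_ocObjective_procCovPenalty hW hRrate (by positivity) N).lowerSemicontinuous

theorem exists_stronglyMidconvexAt_procCovPenalty (hW : P.weight.PosDef)
    (hRrate : P.Rrate.PosDef) : ∃ c > 0, ∀ (N : ℕ) (k : Fin (N + 1)) (β : ℝ), 0 < β →
      StronglyMidconvexAt c k (P.ocObjective (P.procCovPenalty β) N) := by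
  obtain ⟨c, hc, h⟩ := hW.exists_le_quadForm
  refine ⟨c / 2, half_pos hc, fun N k β hβ => ?_⟩
  have hp := P.covMidconvex_procCovPenalty hRrate hβ
  have hR : CovMidconvex (c / 2) P.measCov := by
    rw [measCov]
    exact covMidconvex_inv ((isUnit_iff_isUnit_det _).1 hW.isUnit) hc.le h
  unfold ocObjective
  exact stronglyMidconvexAt_smootherObjective hp hp hR _ _ N k

theorem ocObjective_restrict (hW : P.weight.PosDef) (hRrate : P.Rrate.PosDef) (N : ℕ)
    (χ : ℕ → Fin n ⊕ Fin m → ℝ) :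
    P.ocObjective P.procCov N (fun k => χ k)
      = P.lqrObjectiveUpTo N (fun k => χ k ∘ Sum.inl) (fun k => χ k ∘ Sum.inr) := by
  rw [← P.ocObjective_procCov hW hRrate]
  simp only [Sum.elim_comp_inl_inr]

theorem exists_ocObjective_procCov_ne_top (hW : P.weight.PosDef) (hRrate : P.Rrate.PosDef)
    (N : ℕ) : ∃ χ, P.ocObjective P.procCov N χ ≠ ⊤ := by
  -- The zero control with its trajectory is always feasible at finite cost over a finite horizon.
  let x : ℕ → Fin n → ℝ := fun k => Nat.rec P.xinit (fun _ y => P.A *ᵥ y + P.B *ᵥ 0) k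
  refine ⟨fun k => Sum.elim (x k) 0, ?_⟩
  rw [P.ocObjective_procCov hW hRrate N x fun _ => 0, lqrObjectiveUpTo, if_pos ⟨rfl, fun k _ => rfl⟩]
  exact ENNReal.sum_ne_top.2 fun _ _ => ENNReal.ofReal_ne_top

theorem existsUnique_isMinOn_procCovPenalty (hW : P.weight.PosDef) (hRrate : P.Rrate.PosDef)
    (N : ℕ) {β : ℝ} (hβ : 0 < β) :
    ∃! χ, IsMinOn (P.ocObjective (P.procCovPenalty β) N) univ χ := by
  obtain ⟨c, hc, hconv⟩ := P.exists_stronglyMidconvexAt_procCovPenalty hW hRrate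
  obtain ⟨χ, hχ⟩ := P.exists_ocObjective_procCov_ne_top hW hRrate N
  refine existsUnique_isMinOn_of_stronglyMidconvexAt hc
    (P.continuous_ocObjective_procCovPenalty hW hRrate hβ N).lowerSemicontinuous
    (fun k => hconv N k β hβ) ⟨χ, ne_top_of_le_ne_top hχ ?_⟩
  refine ge_of_tendsto (P.tendsto_ocObjective_procCovPenalty hRrate N χ) ?_
  filter_upwards [eventually_ge_atTop β] with γ hγ
    using P.ocObjective_procCovPenalty_mono hRrate hβ hγ N χ

theorem exists_stronglyMidconvexAt_procCov (hW : P.weight.PosDef) (hRrate : P.Rrate.PosDef) :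
    ∃ c > 0, ∀ (N : ℕ) (k : Fin (N + 1)), StronglyMidconvexAt c k (P.ocObjective P.procCov N) := by
  obtain ⟨c, hc, hconv⟩ := P.exists_stronglyMidconvexAt_procCovPenalty hW hRrate
  exact ⟨c, hc, fun N k => .of_tendsto ((eventually_gt_atTop 0).mono fun β hβ => hconv N k β hβ)
    (P.tendsto_ocObjective_procCovPenalty hRrate N)⟩

theorem existsUnique_isMinOn_procCov (hW : P.weight.PosDef) (hRrate : P.Rrate.PosDef) (N : ℕ) :
    ∃! χ, IsMinOn (P.ocObjective P.procCov N) univ χ := by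
  obtain ⟨c, hc, hconv⟩ := P.exists_stronglyMidconvexAt_procCov hW hRrate
  exact existsUnique_isMinOn_of_stronglyMidconvexAt hc
    (P.lowerSemicontinuous_ocObjective hW hRrate N) (hconv N)
    (P.exists_ocObjective_procCov_ne_top hW hRrate N)

/-- Optimal values and minimizers converge as the penalty on dynamics errors grows. -/
theorem tendsto_iInf_and_minimizers_procCovPenalty (hW : P.weight.PosDef)
    (hRrate : P.Rrate.PosDef) (N : ℕ) {χβ : ℝ → Fin (N + 1) → Fin n ⊕ Fin m → ℝ}
    (hχβ : ∀ β, 0 < β → IsMinOn (P.ocObjective (P.procCovPenalty β) N) univ (χβ β)) :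
    Tendsto (fun β : ℝ => ⨅ χ, P.ocObjective (P.procCovPenalty β) N χ) atTop
        (𝓝 (⨅ χ, P.ocObjective P.procCov N χ)) ∧
      ∃ χ, Tendsto χβ atTop (𝓝 χ) ∧ IsMinOn (P.ocObjective P.procCov N) univ χ := by
  obtain ⟨c, hc, hconv⟩ := P.exists_stronglyMidconvexAt_procCovPenalty hW hRrate
  have hpos : ∀ β : ℝ, 0 < max β 1 := fun β => by positivity
  have hmax : ∀ᶠ β : ℝ in atTop, max β 1 = β := by
    filter_upwards [eventually_ge_atTop 1] with β hβ using max_eq_left hβ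
  obtain ⟨h1, h2⟩ := exists_tendsto_of_minimizers hc
    (F := fun β : ℝ => P.ocObjective (P.procCovPenalty (max β 1)) N)
    (G := P.ocObjective P.procCov N) (x := fun β => χβ (max β 1))
    (fun β γ h χ => P.ocObjective_procCovPenalty_mono hRrate (hpos β) (max_le_max h le_rfl) N χ)
    (fun β => (P.continuous_ocObjective_procCovPenalty hW hRrate (hpos β) N).lowerSemicontinuous)
    (fun k => Eventually.of_forall fun β => hconv N k _ (hpos β))
    (fun χ => (P.tendsto_ocObjective_procCovPenalty hRrate N χ).congr'
      (hmax.mono fun β hβ => by simp only [hβ]))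
    (fun β y => hχβ _ (hpos β) (mem_univ y))
  obtain ⟨χ, hχ, hmin⟩ := h2 (P.exists_ocObjective_procCov_ne_top hW hRrate N)
  exact ⟨h1.congr' (hmax.mono fun β hβ => by simp only [hβ]),
    χ, hχ.congr' (hmax.mono fun β hβ => by rw [hβ]), fun y _ => hmin y⟩

/-! ### Passage to the infinite horizon. -/

theorem iInf_lqrObjective :
    ⨅ χ : ℕ → Fin n ⊕ Fin m → ℝ,
        P.lqrObjective (fun k => χ k ∘ Sum.inl) (fun k => χ k ∘ Sum.inr)
      = ⨅ (x : ℕ → Fin n → ℝ) (u : ℕ → Fin m → ℝ), P.lqrObjective x u :=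
  le_antisymm
    (le_iInf₂ fun x u => (iInf_le _ fun k => Sum.elim (x k) (u k)).trans_eq (by
      simp only [Sum.elim_comp_inl, Sum.elim_comp_inr]))
    (le_iInf fun _ => iInf₂_le _ _)

theorem surjective_restrict_fin (N : ℕ) (V : Type*) [Zero V] :
    Function.Surjective fun (χ : ℕ → V) (k : Fin (N + 1)) => χ k := fun χ =>
  ⟨fun k => if h : k < N + 1 then χ ⟨k, h⟩ else 0, funext fun k => dif_pos k.2⟩

/-- Optimal values and minimizers converge as the horizon grows. -/
theorem tendsto_iInf_and_minimizers_procCov (hW : P.weight.PosDef) (hRrate : P.Rrate.PosDef)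
    {χ : (N : ℕ) → Fin (N + 1) → Fin n ⊕ Fin m → ℝ}
    (hχ : ∀ N, IsMinOn (P.ocObjective P.procCov N) univ (χ N)) :
    Tendsto (fun N : ℕ => ⨅ χ, P.ocObjective P.procCov N χ) atTop
        (𝓝 (⨅ (x : ℕ → Fin n → ℝ) (u : ℕ → Fin m → ℝ), P.lqrObjective x u)) ∧
      ((∃ (x : ℕ → Fin n → ℝ) (u : ℕ → Fin m → ℝ), P.lqrObjective x u < ⊤) →
        ∃ (x : ℕ → Fin n → ℝ) (u : ℕ → Fin m → ℝ),
          (∀ x' u', P.lqrObjective x u ≤ P.lqrObjective x' u') ∧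
          ∀ (k : ℕ) (hk : ∀ j, k < k + j + 1),
            Tendsto (fun j : ℕ => χ (k + j) ⟨k, hk j⟩) atTop (𝓝 (Sum.elim (x k) (u k)))) := by
  obtain ⟨c, hc, hconv⟩ := P.exists_stronglyMidconvexAt_procCov hW hRrate
  -- All horizons are placed on the common space of infinite sequences. The objective ignores
  -- entries beyond `N`, so any extension of a minimizer remains one.
  choose y hy using fun N => surjective_restrict_fin N _ (χ N)
  have hy' : ∀ N (k : Fin (N + 1)), y N k = χ N k := fun N k => congrFun (hy N) k
  obtain ⟨h1, h2⟩ := exists_tendsto_of_minimizers hc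
    (F := fun (N : ℕ) (χ : ℕ → Fin n ⊕ Fin m → ℝ) => P.ocObjective P.procCov N fun k => χ k)
    (G := fun χ => P.lqrObjective (fun k => χ k ∘ Sum.inl) (fun k => χ k ∘ Sum.inr)) (x := y)
    (fun N N' h χ => by
      simp only [P.ocObjective_restrict hW hRrate]
      exact P.lqrObjectiveUpTo_mono _ _ h)
    (fun N => (P.lowerSemicontinuous_ocObjective hW hRrate N).comp (by fun_prop))
    -- Horizon `N` controls coordinate `k` only once `N ≥ k`, hence the eventual form of the
    -- convexity hypothesis.
    (fun k => (eventually_ge_atTop k).mono fun N hN a b =>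
      hconv N ⟨k, by omega⟩ (fun k => a k) (fun k => b k))
    (fun χ => by
      simp only [P.ocObjective_restrict hW hRrate]
      exact P.tendsto_lqrObjectiveUpTo _ _)
    (fun N z => by
      simp only [hy']
      exact hχ N (mem_univ fun k => z k))
  constructor
  · rw [iInf_lqrObjective] at h1
    refine h1.congr fun N => ?_
    exact (surjective_restrict_fin N _).iInf_comp (P.ocObjective P.procCov N)
  · rintro ⟨x, u, hxu⟩
    obtain ⟨a, ha, hmin⟩ := h2 ⟨fun k => Sum.elim (x k) (u k), by
      simpa only [Sum.elim_comp_inl, Sum.elim_comp_inr] using hxu.ne⟩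
    refine ⟨fun k => a k ∘ Sum.inl, fun k => a k ∘ Sum.inr, fun x' u' => ?_, fun k hk => ?_⟩
    · simpa only [Sum.elim_comp_inl, Sum.elim_comp_inr] using
        hmin fun k => Sum.elim (x' k) (u' k)
    · rw [Sum.elim_comp_inl_inr]
      have h := ((tendsto_pi_nhds.1 ha k).comp (tendsto_add_atTop_nat k))
      refine h.congr fun j => ?_
      rw [Function.comp_apply, add_comm j k]
      exact hy' (k + j) ⟨k, hk j⟩

/-- The infinite-horizon objective inherits the modulus in every coordinate as a pointwise limit of
the truncated ones, which forces uniqueness. -/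
theorem eq_of_lqrObjective_le (hW : P.weight.PosDef) (hRrate : P.Rrate.PosDef)
    {x x' : ℕ → Fin n → ℝ} {u u' : ℕ → Fin m → ℝ} (hfin : P.lqrObjective x u ≠ ⊤)
    (hmin : ∀ y v, P.lqrObjective x u ≤ P.lqrObjective y v)
    (hle : P.lqrObjective x' u' ≤ P.lqrObjective x u) : x' = x ∧ u' = u := by
  obtain ⟨c, hc, hconv⟩ := P.exists_stronglyMidconvexAt_procCov hW hRrate
  have hG : ∀ k, StronglyMidconvexAt c k fun χ : ℕ → Fin n ⊕ Fin m → ℝ =>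
      P.lqrObjective (fun k => χ k ∘ Sum.inl) (fun k => χ k ∘ Sum.inr) := fun k =>
    .of_tendsto (l := atTop)
      (F := fun (N : ℕ) (χ : ℕ → Fin n ⊕ Fin m → ℝ) => P.ocObjective P.procCov N fun k => χ k)
      ((eventually_ge_atTop k).mono fun N hN a b =>
        hconv N ⟨k, by omega⟩ (fun k => a k) (fun k => b k))
      (fun χ => by
        simp only [P.ocObjective_restrict hW hRrate]
        exact P.tendsto_lqrObjectiveUpTo _ _)
  have h := eq_of_isMinOn_of_stronglyMidconvexAt hc hG
    (a := fun k => Sum.elim (x k) (u k)) (b := fun k => Sum.elim (x' k) (u' k))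
    (by simpa only [Sum.elim_comp_inl, Sum.elim_comp_inr] using fun y => hmin _ _)
    (by simpa only [Sum.elim_comp_inl, Sum.elim_comp_inr] using hle)
    (by simpa only [Sum.elim_comp_inl, Sum.elim_comp_inr] using hfin)
  constructor <;> funext k i
  · exact (congrFun (congrFun h k) (Sum.inl i)).symm
  · exact (congrFun (congrFun h k) (Sum.inr i)).symm

end LQRData

theorem theorem1 {n m : ℕ} (P : LQRData n m)
    (hW : P.weight.PosDef) (hRrate : P.Rrate.PosDef) :
    -- The objective with process covariance `diag(0, Rrate⁻¹)` is the truncated LQR problem,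
    (∀ (N : ℕ) (x : ℕ → Fin n → ℝ) (u : ℕ → Fin m → ℝ),
      P.ocObjective P.procCov N (fun k => Sum.elim (x k) (u k)) = P.lqrObjectiveUpTo N x u) ∧
    -- it converges to the LQR objective as `N → ∞`,
    (∀ (x : ℕ → Fin n → ℝ) (u : ℕ → Fin m → ℝ),
      Tendsto (fun N : ℕ => P.ocObjective P.procCov N (fun k => Sum.elim (x k) (u k))) atTop
        (𝓝 (P.lqrObjective x u))) ∧
    -- and so do its optimal values and its minimizers.
    Tendsto (fun N : ℕ => ⨅ χ, P.ocObjective P.procCov N χ) atTop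
      (𝓝 (⨅ (x : ℕ → Fin n → ℝ) (u : ℕ → Fin m → ℝ), P.lqrObjective x u)) ∧
    (∀ N : ℕ, ∃! χ, IsMinOn (P.ocObjective P.procCov N) univ χ) ∧
    ((∃ (x : ℕ → Fin n → ℝ) (u : ℕ → Fin m → ℝ), P.lqrObjective x u < ⊤) →
      ∃ (x : ℕ → Fin n → ℝ) (u : ℕ → Fin m → ℝ),
        (∀ (x' : ℕ → Fin n → ℝ) (u' : ℕ → Fin m → ℝ),
          P.lqrObjective x u ≤ P.lqrObjective x' u' ∧
          (P.lqrObjective x' u' ≤ P.lqrObjective x u → x' = x ∧ u' = u)) ∧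
        ∀ χ : (N : ℕ) → Fin (N + 1) → Fin n ⊕ Fin m → ℝ,
          (∀ N, IsMinOn (P.ocObjective P.procCov N) univ (χ N)) →
          ∀ k : ℕ, Tendsto (fun j : ℕ => χ (k + j) ⟨k, by omega⟩) atTop
            (𝓝 (Sum.elim (x k) (u k)))) ∧
    -- The zero block arises as the limit `β → ∞` of a penalty on dynamics errors.
    Tendsto P.procCovPenalty atTop (𝓝 P.procCov) ∧
    (∀ (N : ℕ) (χ : Fin (N + 1) → Fin n ⊕ Fin m → ℝ),
      Tendsto (fun β : ℝ => P.ocObjective (P.procCovPenalty β) N χ) atTop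
        (𝓝 (P.ocObjective P.procCov N χ))) ∧
    (∀ N : ℕ, Tendsto (fun β : ℝ => ⨅ χ, P.ocObjective (P.procCovPenalty β) N χ) atTop
        (𝓝 (⨅ χ, P.ocObjective P.procCov N χ))) ∧
    (∀ (N : ℕ) (β : ℝ), 0 < β →
      ∃! χ, IsMinOn (P.ocObjective (P.procCovPenalty β) N) univ χ) ∧
    (∀ (N : ℕ) (χβ : ℝ → Fin (N + 1) → Fin n ⊕ Fin m → ℝ)
      (χ : Fin (N + 1) → Fin n ⊕ Fin m → ℝ),
      (∀ β, 0 < β → IsMinOn (P.ocObjective (P.procCovPenalty β) N) univ (χβ β)) →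
      IsMinOn (P.ocObjective P.procCov N) univ χ →
      Tendsto χβ atTop (𝓝 χ)) := by

  have hmin := P.existsUnique_isMinOn_procCov hW hRrate
  have hminβ := fun (N : ℕ) (β : ℝ) (hβ : 0 < β) =>
    P.existsUnique_isMinOn_procCovPenalty hW hRrate N hβ
  choose χmin hχmin using fun N => (hmin N).exists
  have hχminβ : ∀ N : ℕ, ∃ χβ : ℝ → Fin (N + 1) → Fin n ⊕ Fin m → ℝ,
      ∀ β, 0 < β → IsMinOn (P.ocObjective (P.procCovPenalty β) N) univ (χβ β) := fun N =>
    ⟨fun β => if hβ : 0 < β then (hminβ N β hβ).choose else 0, fun β hβ => by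
      simpa only [dif_pos hβ] using (hminβ N β hβ).choose_spec.1⟩
  refine ⟨P.ocObjective_procCov hW hRrate, fun x u => ?_,
    (P.tendsto_iInf_and_minimizers_procCov hW hRrate hχmin).1, hmin, fun hfin => ?_,
    P.tendsto_procCovPenalty hRrate, P.tendsto_ocObjective_procCovPenalty hRrate, fun N => ?_,
    hminβ, fun N χβ χ hχβ hχ => ?_⟩
  · simp only [P.ocObjective_procCov hW hRrate]
    exact P.tendsto_lqrObjectiveUpTo x u
  · obtain ⟨x, u, hxu, hlim⟩ :=
      (P.tendsto_iInf_and_minimizers_procCov hW hRrate hχmin).2 hfin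
    obtain ⟨y, v, hyv⟩ := hfin
    refine ⟨x, u, fun x' u' => ⟨hxu x' u', P.eq_of_lqrObjective_le hW hRrate
      ((hxu y v).trans_lt hyv).ne hxu⟩, fun χ hχ k => ?_⟩
    -- The limit pair was built from the chosen minimizers; uniqueness at each horizon makes it
    -- serve every choice.
    obtain rfl : χ = χmin := funext fun N => (hmin N).unique (hχ N) (hχmin N)
    exact hlim k _
  · obtain ⟨χβ, hχβ⟩ := hχminβ N
    exact (P.tendsto_iInf_and_minimizers_procCovPenalty hW hRrate N hχβ).1
  · obtain ⟨χ', hlim, hχ'⟩ := (P.tendsto_iInf_and_minimizers_procCovPenalty hW hRrate N hχβ).2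
    rwa [(hmin N).unique hχ hχ']
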